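/- **Setting.** Let $\Omega\subset\mathbb R^2$ be open, bounded and simply connected, with smooth boundary. Let $\Omega_1,\Omega_2\subset\mathbb R^2$ be disjoint open sets, each with finitely many connected components and with piecewise smooth boundary having finitely many corners, and put $\Gamma=\partial\Omega_1\cap\partial\Omega_2$. Assume that $\Omega=(\Omega_1\cup\Omega_2\cup\Gamma)^\circ$, that $\Gamma$ is the union of a finite number of disjoint simple smooth curves $\Gamma_k$, and that each $\Gamma_k$ meets $\partial\Omega$ at exactly two distinct points, transversally. Let $a\in[-1,1)\setminus\{0\}$ and $B_0=\mathbf 1_{\Omega_1}+a\,\mathbf 1_{\Omega_2}$. Let $H^1_{\rm div}(\Omega)=\{\mathbf A\in H^1(\Omega;\mathbb R^2):\operatorname{div}\mathbf A=0\text{ in }\Omega,\ \mathbf A\cdot\nu=0\text{ on }\partial\Omega\}$, with $\nu$ a unit normal of $\partial\Omega$, and let $\mathbf F$ be the unique element of $H^1_{\rm div}(\Omega)$ with $\operatorname{curl}\mathbf F=B_0$. For $\kappa,H>0$, $\psi\in H^1(\Omega;\mathbb C)$ and $\mathbf A\in H^1_{\rm div}(\Omega)$ let $$\mathcal E_{\kappa,H}(\psi,\mathbf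 A)=\int_\Omega\Big(|(\nabla-i\kappa H\mathbf A)\psi|^2-\kappa^2|\psi|^2+\frac{\kappa^2}{2}|\psi|^4\Big)dx+\kappa^2H^2\int_\Omega|\operatorname{curl}\mathbf A-B_0|^2\,dx ;$$ minimizers of $\mathcal E_{\kappa,H}$ are taken over $H^1(\Omega;\mathbb C)\times H^1_{\rm div}(\Omega)$. For $\mathfrak b>0$ let $$\lambda(\mathfrak b)=\inf\Big\{\frac{\int_\Omega|(\nabla-i\mathfrak b\mathbf F)u|^2dx}{\int_\Omega|u|^2dx}\ :\ 0\neq u\in L^2(\Omega),\ (\nabla-i\mathfrak b\mathbf F)u\in L^2(\Omega)\Big\}$$ be the ground-state energy of the Neumann realization of $-(\nabla-i\mathfrak b\mathbf F)^2$ in $\Omega$. Define the global critical fields $$\overline H_{C_3}(\kappa)=\inf\{H>0:\text{for all }H'>H,\ (0,\mathbf F)\text{ is the only minimizer of }\mathcal E_{\kappa,H'}\},$$ $$\underline H_{C_3}(\kappa)=\inf\{H>0:(0,\mathbf F)\text{ is the only minimizer of }\mathcal E_{\kappa,H}\},$$ and the local critical fields $$\overline H^{\rm loc}_{C_3}(\kappa)=\inf\{H>0:\text{for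 all }H'>H,\ \lambda(\kappa H')\ge\kappa^2\},\qquad \underline H^{\rm loc}_{C_3}(\kappa)=\inf\{H>0:\lambda(\kappa H)\ge\kappa^2\},$$ with the convention $\inf\emptyset=+\infty$. **Theorem.** For every $\kappa>0$, $$\overline H_{C_3}(\kappa)\ \ge\ \overline H^{\rm loc}_{C_3}(\kappa)\qquad\text{and}\qquad \underline H_{C_3}(\kappa)\ \ge\ \underline H^{\rm loc}_{C_3}(\kappa).$$ -/

import Mathlib

open Set MeasureTheory Filter
open scoped Topology ContDiff

namespace GinzburgLandau

/-- The Euclidean plane. -/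
abbrev Plane : Type := EuclideanSpace ℝ (Fin 2)

/-! ### Geometry of the sample -/

/-- `ρ` is a smooth defining function of `Ω` near `p`: close to `p`, the set `Ω` is `{ρ < 0}`,
and `ρ` vanishes at `p` with a nonzero differential. -/
structure IsDefiningFunctionAt (Ω : Set Plane) (p : Plane) (ρ : Plane → ℝ) : Prop where
  smooth : ContDiff ℝ ∞ ρ
  zero : ρ p = 0
  fderiv_ne : fderiv ℝ ρ p ≠ 0
  local_eq : ∀ᶠ x in 𝓝 p, (x ∈ Ω ↔ ρ x < 0)

/-- The boundary of `Ω` is smooth at `p`. -/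
def SmoothBoundaryAt (Ω : Set Plane) (p : Plane) : Prop :=
  ∃ ρ : Plane → ℝ, IsDefiningFunctionAt Ω p ρ

/-- `Ω` has a corner at `p`: near `p`, the set `Ω` is bounded by two smooth arcs that cross
transversally at `p` (opening angle below `π` in the first case, above `π` in the second). -/
def CornerAt (Ω : Set Plane) (p : Plane) : Prop :=
  ∃ ρ σ : Plane → ℝ, ContDiff ℝ ∞ ρ ∧ ContDiff ℝ ∞ σ ∧ ρ p = 0 ∧ σ p = 0 ∧
    LinearIndependent ℝ ![fderiv ℝ ρ p, fderiv ℝ σ p] ∧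
    ((∀ᶠ x in 𝓝 p, (x ∈ Ω ↔ ρ x < 0 ∧ σ x < 0)) ∨
      (∀ᶠ x in 𝓝 p, (x ∈ Ω ↔ ρ x < 0 ∨ σ x < 0)))

/-- The boundary of `Ω` is smooth. -/
def SmoothBoundary (Ω : Set Plane) : Prop :=
  ∀ p ∈ frontier Ω, SmoothBoundaryAt Ω p

/-- The boundary of `Ω` is piecewise smooth with a finite number of corners. -/
def PiecewiseSmoothBoundary (Ω : Set Plane) : Prop :=
  ∃ S : Set Plane, S.Finite ∧ (∀ p ∈ frontier Ω \ S, SmoothBoundaryAt Ω p) ∧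
    ∀ p ∈ frontier Ω ∩ S, CornerAt Ω p

/-- `γ`, restricted to `[0, 1]`, is a regular parametrization of a simple smooth curve. -/
structure IsSimpleSmoothCurve (γ : ℝ → Plane) : Prop where
  smooth : ContDiff ℝ ∞ γ
  injOn : InjOn γ (Icc 0 1)
  deriv_ne : ∀ t ∈ Icc (0 : ℝ) 1, deriv γ t ≠ 0

/-- The curve `γ([0, 1])` is nowhere tangent to the boundary of `Ω` where it meets it. -/
def TransversalToBoundary (Ω : Set Plane) (γ : ℝ → Plane) : Prop :=
  ∀ t ∈ Icc (0 : ℝ) 1, γ t ∈ frontier Ω →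
    ∀ ρ : Plane → ℝ, IsDefiningFunctionAt Ω (γ t) ρ → fderiv ℝ ρ (γ t) (deriv γ t) ≠ 0

/-- The assumptions on the sample `Ω`, its two parts `Ω₁` and `Ω₂`, the magnetic barrier
`Γ = ∂Ω₁ ∩ ∂Ω₂`, and the value `a` of the magnetic field in `Ω₂`. -/
structure StepSample (Ω Ω₁ Ω₂ : Set Plane) (a : ℝ) : Prop where
  isOpen : IsOpen Ω
  bounded : Bornology.IsBounded Ω
  simplyConnected : SimplyConnectedSpace Ω
  isOpen₁ : IsOpen Ω₁
  isOpen₂ : IsOpen Ω₂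
  disjoint : Disjoint Ω₁ Ω₂
  finite_components₁ : Finite (ConnectedComponents Ω₁)
  finite_components₂ : Finite (ConnectedComponents Ω₂)
  piecewiseSmooth₁ : PiecewiseSmoothBoundary Ω₁
  piecewiseSmooth₂ : PiecewiseSmoothBoundary Ω₂
  eq_interior : Ω = interior (Ω₁ ∪ Ω₂ ∪ (frontier Ω₁ ∩ frontier Ω₂))
  smoothBoundary : SmoothBoundary Ω
  barrier : ∃ (N : ℕ) (γ : Fin N → ℝ → Plane),
    (∀ k, IsSimpleSmoothCurve (γ k)) ∧
    Pairwise (fun k l => Disjoint (γ k '' Icc 0 1) (γ l '' Icc 0 1)) ∧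
    frontier Ω₁ ∩ frontier Ω₂ = ⋃ k, γ k '' Icc 0 1 ∧
    ∀ k, (γ k '' Icc 0 1 ∩ frontier Ω).encard = 2 ∧ TransversalToBoundary Ω (γ k)
  neg_one_le : -1 ≤ a
  lt_one : a < 1
  ne_zero : a ≠ 0

/-- The step magnetic field `𝟙_{Ω₁} + a 𝟙_{Ω₂}`. -/
noncomputable def stepField (Ω₁ Ω₂ : Set Plane) (a : ℝ) (x : Plane) : ℝ :=
  Ω₁.indicator (fun _ => 1) x + Ω₂.indicator (fun _ => a) x

/-! ### Weak derivatives and function spaces -/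

section Sobolev

variable {V : Type*} [NormedAddCommGroup V] [NormedSpace ℝ V]

/-- The classical partial derivative in the `j`-th coordinate direction. -/
noncomputable def partialDeriv (j : Fin 2) (φ : Plane → ℝ) (x : Plane) : ℝ :=
  fderiv ℝ φ x (EuclideanSpace.single j 1)

/-- `g` is the weak `j`-th partial derivative of `u` in the open set `Ω`. -/
def HasWeakDeriv (Ω : Set Plane) (j : Fin 2) (u g : Plane → V) : Prop :=
  LocallyIntegrableOn u Ω ∧ LocallyIntegrableOn g Ω ∧
    ∀ φ : Plane → ℝ, ContDiff ℝ ∞ φ → HasCompactSupport φ → tsupport φ ⊆ Ω →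
      ∫ x in Ω, partialDeriv j φ x • u x = - ∫ x in Ω, φ x • g x

open Classical in
/-- The weak `j`-th partial derivative of `u` in `Ω`, which is unique up to equality almost
everywhere in `Ω` (and `0` if there is none). -/
noncomputable def weakDeriv (Ω : Set Plane) (j : Fin 2) (u : Plane → V) : Plane → V :=
  if h : ∃ g, HasWeakDeriv Ω j u g then h.choose else 0

/-- Membership in the Sobolev space `H¹(Ω; V)`. -/
def MemH1 (Ω : Set Plane) (u : Plane → V) : Prop :=
  MemLp u 2 (volume.restrict Ω) ∧
    ∀ j, ∃ g : Plane → V, MemLp g 2 (volume.restrict Ω) ∧ HasWeakDeriv Ω j u g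

end Sobolev

/-- The divergence of a vector field, in the weak sense. -/
noncomputable def weakDiv (Ω : Set Plane) (A : Plane → Plane) (x : Plane) : ℝ :=
  weakDeriv Ω 0 (fun y => A y 0) x + weakDeriv Ω 1 (fun y => A y 1) x

/-- The curl of a vector field, in the weak sense. -/
noncomputable def weakCurl (Ω : Set Plane) (A : Plane → Plane) (x : Plane) : ℝ :=
  weakDeriv Ω 0 (fun y => A y 1) x - weakDeriv Ω 1 (fun y => A y 0) x

/-- `A · ν = 0` on the boundary of `Ω`, in the sense of normal traces: the boundary term in
Green's formula vanishes for every function that is smooth up to the boundary. -/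
def NormalTraceZero (Ω : Set Plane) (A : Plane → Plane) : Prop :=
  ∀ φ : Plane → ℝ, ContDiff ℝ ∞ φ → HasCompactSupport φ →
    ∫ x in Ω, ((∑ j, A x j * partialDeriv j φ x) + weakDiv Ω A x * φ x) = 0

/-- The space of vector fields `A ∈ H¹(Ω; ℝ²)` with `div A = 0` in `Ω` and `A · ν = 0` on the
boundary of `Ω`. -/
structure MemH1Div (Ω : Set Plane) (A : Plane → Plane) : Prop where
  memH1 : ∀ j, MemH1 Ω (fun x => A x j)
  div_eq : ∀ᵐ x ∂volume.restrict Ω, weakDiv Ω A x = 0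
  normalTrace : NormalTraceZero Ω A

/-- `F` is the vector potential in `H¹_div(Ω)` that generates the magnetic field `B`. -/
def IsPotentialOf (Ω : Set Plane) (B : Plane → ℝ) (F : Plane → Plane) : Prop :=
  MemH1Div Ω F ∧ ∀ᵐ x ∂volume.restrict Ω, weakCurl Ω F x = B x

/-! ### The linear operator -/

/-- The `j`-th component of the magnetic gradient `(∇ - i b E) u`. -/
noncomputable def magDeriv (Ω : Set Plane) (b : ℝ) (E : Plane → Plane) (j : Fin 2)
    (u : Plane → ℂ) (x : Plane) : ℂ :=
  weakDeriv Ω j u x - Complex.I * (b : ℂ) * (E x j : ℂ) * u x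

/-- The form domain: `u ∈ L²(Ω)` with `(∇ - i b E) u ∈ L²(Ω)`. -/
def MemFormDomain (Ω : Set Plane) (b : ℝ) (E : Plane → Plane) (u : Plane → ℂ) : Prop :=
  MemLp u 2 (volume.restrict Ω) ∧
    ∀ j, (∃ g, HasWeakDeriv Ω j u g) ∧ MemLp (magDeriv Ω b E j u) 2 (volume.restrict Ω)

/-- The quadratic form `∫_Ω |(∇ - i b E) u|²`. -/
noncomputable def magForm (Ω : Set Plane) (b : ℝ) (E : Plane → Plane) (u : Plane → ℂ) : ℝ :=
  ∫ x in Ω, ∑ j, ‖magDeriv Ω b E j u x‖ ^ 2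

/-- The ground-state energy of the Neumann realization of `-(∇ - i b E)²` in `Ω`. -/
noncomputable def groundEnergy (Ω : Set Plane) (E : Plane → Plane) (b : ℝ) : ℝ :=
  sInf {r : ℝ | ∃ u : Plane → ℂ, MemFormDomain Ω b E u ∧ ¬ u =ᵐ[volume.restrict Ω] 0 ∧
    r = magForm Ω b E u / ∫ x in Ω, ‖u x‖ ^ 2}

/-! ### The Ginzburg-Landau functional -/

/-- The Ginzburg-Landau energy of `(ψ, A)` with applied magnetic field `B`. On a bounded smooth
domain every term is integrable for `ψ` and `A` in `H¹`, since `H¹ ⊆ L⁴`. -/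
noncomputable def glEnergy (Ω : Set Plane) (B : Plane → ℝ) (κ H : ℝ) (ψ : Plane → ℂ)
    (A : Plane → Plane) : ℝ :=
  (∫ x in Ω, ((∑ j, ‖magDeriv Ω (κ * H) A j ψ x‖ ^ 2) - κ ^ 2 * ‖ψ x‖ ^ 2
      + κ ^ 2 / 2 * ‖ψ x‖ ^ 4))
    + κ ^ 2 * H ^ 2 * ∫ x in Ω, |weakCurl Ω A x - B x| ^ 2

/-- `(ψ, A)` minimizes the Ginzburg-Landau energy over `H¹(Ω; ℂ) × H¹_div(Ω)`. -/
def IsGLMinimizer (Ω : Set Plane) (B : Plane → ℝ) (κ H : ℝ) (ψ : Plane → ℂ)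
    (A : Plane → Plane) : Prop :=
  MemH1 Ω ψ ∧ MemH1Div Ω A ∧
    ∀ (ψ' : Plane → ℂ) (A' : Plane → Plane), MemH1 Ω ψ' → MemH1Div Ω A' →
      glEnergy Ω B κ H ψ A ≤ glEnergy Ω B κ H ψ' A'

/-- The normal state `(0, F)` is the only minimizer, up to equality almost everywhere. -/
def NormalIsOnlyMinimizer (Ω : Set Plane) (B : Plane → ℝ) (F : Plane → Plane) (κ H : ℝ) : Prop :=
  IsGLMinimizer Ω B κ H 0 F ∧
    ∀ (ψ : Plane → ℂ) (A : Plane → Plane), IsGLMinimizer Ω B κ H ψ A →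
      ψ =ᵐ[volume.restrict Ω] 0 ∧ A =ᵐ[volume.restrict Ω] F

/-! ### Critical fields

The infima are taken in the extended reals, so that the infimum of the empty set is `+∞`. -/

/-- The upper global critical field. -/
noncomputable def upperGlobalField (Ω : Set Plane) (B : Plane → ℝ) (F : Plane → Plane)
    (κ : ℝ) : EReal :=
  sInf ((fun H : ℝ => (H : EReal)) ''
    {H : ℝ | 0 < H ∧ ∀ H' : ℝ, H < H' → NormalIsOnlyMinimizer Ω B F κ H'})

/-- The lower global critical field. -/
noncomputable def lowerGlobalField (Ω : Set Plane) (B : Plane → ℝ) (F : Plane → Plane)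
    (κ : ℝ) : EReal :=
  sInf ((fun H : ℝ => (H : EReal)) '' {H : ℝ | 0 < H ∧ NormalIsOnlyMinimizer Ω B F κ H})

/-- The upper local critical field. -/
noncomputable def upperLocalField (Ω : Set Plane) (F : Plane → Plane) (κ : ℝ) : EReal :=
  sInf ((fun H : ℝ => (H : EReal)) ''
    {H : ℝ | 0 < H ∧ ∀ H' : ℝ, H < H' → κ ^ 2 ≤ groundEnergy Ω F (κ * H')})

/-- The lower local critical field. -/
noncomputable def lowerLocalField (Ω : Set Plane) (F : Plane → Plane) (κ : ℝ) : EReal :=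
  sInf ((fun H : ℝ => (H : EReal)) '' {H : ℝ | 0 < H ∧ κ ^ 2 ≤ groundEnergy Ω F (κ * H)})

end GinzburgLandau

/-!
The comparison holds field by field: if the normal state `(0, F)` minimizes the Ginzburg–Landau
energy at `(κ, H)`, then `κ² ≤ λ(κH)` (`IsGLMinimizer.sq_le_groundEnergy`). The sets whose infima
are the global critical fields are thus contained in those of the local ones.

For the field-by-field claim, suppose that `λ(κH) < κ²`. Some `u` in the form domain then satisfies
`∫ |(∇ - iκHF)u|² < κ² ∫ |u|²`, and along the ray `t ↦ (tu, F)` the energy is a negative multiple of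
`t²` plus a multiple of `t⁴`, hence negative for small `t`, below the energy `0` of the normal
state (`glEnergy_smul`).

This needs `u ∈ H¹ ∩ L⁴`, whereas the form domain only gives `u, (∇ - iκHF)u ∈ L²`. Instead of
Sobolev embeddings and regularity of `F`, the argument replaces `u` by `u / (1 + ε|u|²)`
(`softTruncation`). This is bounded, so it lies in `L⁴`, and its product with `F ∈ L²` is in `L²`,
so it lies in `H¹`. The truncation is a contraction of `ℂ` that commutes with phase rotations, and
so it does not increase the magnetic gradient pointwise (`norm_magDeriv_softTruncation_le`), while
the `L²` norm converges to that of `u` as `ε → 0`. The Rayleigh quotient therefore stays below `κ²`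
for small `ε` (`exists_bounded_magForm_lt`).

The analytic input is the chain rule for weak derivatives (`HasWeakDeriv.comp`), proved by
mollification: mollified functions converge almost everywhere, and in `L¹` because their `L¹` norms
do not exceed that of the limit (`tendsto_integral_norm_sub_of_tendsto_ae`).
-/

namespace GinzburgLandau

open scoped Convolution

/-! ### Mollification in `L¹` -/

/-- A sequence that converges almost everywhere, and whose `L¹` norms do not exceed that of the
limit, converges in `L¹`. -/
theorem tendsto_integral_norm_sub_of_tendsto_ae {α E : Type*} [MeasurableSpace α] {μ : Measure α}
    [NormedAddCommGroup E] {F : ℕ → α → E} {f : α → E} (hF : ∀ n, Integrable (F n) μ)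
    (hf : Integrable f μ) (hle : ∀ n, ∫ x, ‖F n x‖ ∂μ ≤ ∫ x, ‖f x‖ ∂μ)
    (hlim : ∀ᵐ x ∂μ, Tendsto (fun n => F n x) atTop (𝓝 (f x))) :
    Tendsto (fun n => ∫ x, ‖F n x - f x‖ ∂μ) atTop (𝓝 0) := by
  have hsub : ∀ n, Integrable (fun x => ‖F n x - f x‖) μ := fun n => ((hF n).sub hf).norm
  -- The differences `‖F n - f‖ - ‖F n‖` are dominated by `‖f‖` while `‖F n - f‖` need not be.
  have key : Tendsto (fun n => ∫ x, (‖F n x - f x‖ - ‖F n x‖) ∂μ) atTop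
      (𝓝 (∫ x, -‖f x‖ ∂μ)) := by
    refine tendsto_integral_of_dominated_convergence (fun x => ‖f x‖)
      (fun n => ((hsub n).sub (hF n).norm).aestronglyMeasurable) hf.norm (fun n => ?_) ?_
    · refine Eventually.of_forall fun x => ?_
      have := abs_norm_sub_norm_le (F n x - f x) (F n x)
      simpa using this
    · filter_upwards [hlim] with x hx
      have := ((hx.sub_const (f x)).norm).sub hx.norm
      simpa using this
  have key2 : Tendsto (fun n => ∫ x, (‖F n x - f x‖ - ‖F n x‖) ∂μ + ∫ x, ‖f x‖ ∂μ) atTop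
      (𝓝 0) := by
    have := key.add_const (∫ x, ‖f x‖ ∂μ)
    rwa [integral_neg, neg_add_cancel] at this
  refine squeeze_zero (fun n => integral_nonneg fun x => norm_nonneg _) (fun n => ?_) key2
  rw [integral_sub (hsub n) (hF n).norm]
  linarith [hle n]

/-- A sequence of bump functions on the plane, with radii `1 / (n + 1)` and `2 / (n + 1)`. -/
noncomputable def mollifierBump (n : ℕ) : ContDiffBump (0 : Plane) where
  rIn := 1 / (n + 1)
  rOut := 2 / (n + 1)
  rIn_pos := by positivity
  rIn_lt_rOut := by gcongr; norm_num

theorem tendsto_mollifierBump_rOut :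
    Tendsto (fun n => (mollifierBump n).rOut) atTop (𝓝 0) := by
  have := (tendsto_one_div_add_atTop_nhds_zero_nat (𝕜 := ℝ)).const_mul 2
  simpa [mollifierBump, div_eq_mul_inv] using this

section Mollify

variable {V : Type*} [NormedAddCommGroup V] [NormedSpace ℝ V]

/-- The mollification of `f` at scale `2 / (n + 1)`. -/
noncomputable def mollify (n : ℕ) (f : Plane → V) : Plane → V :=
  (mollifierBump n).normed volume ⋆[ContinuousLinearMap.lsmul ℝ ℝ, volume] f

theorem mollify_apply (n : ℕ) (f : Plane → V) (x : Plane) :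
    mollify n f x = ∫ t, (mollifierBump n).normed volume (x - t) • f t := by
  simp [mollify, convolution_eq_swap]

theorem mollifierBump_normed_integrable (n : ℕ) :
    Integrable ((mollifierBump n).normed volume : Plane → ℝ) :=
  (mollifierBump n).continuous_normed.integrable_of_hasCompactSupport
    (mollifierBump n).hasCompactSupport_normed

theorem contDiff_mollify (n : ℕ) {f : Plane → V} (hf : LocallyIntegrable f) :
    ContDiff ℝ 1 (mollify n f) := by
  exact_mod_cast (mollifierBump n).hasCompactSupport_normed.contDiff_convolution_left
    (n := 1) _ (by exact_mod_cast (mollifierBump n).contDiff_normed) hf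

theorem integrable_mollify (n : ℕ) {f : Plane → V} (hf : Integrable f) :
    Integrable (mollify n f) :=
  (mollifierBump_normed_integrable n).integrable_convolution _ hf

theorem integral_norm_mollify_le (n : ℕ) {f : Plane → V} (hf : Integrable f) :
    ∫ x, ‖mollify n f x‖ ≤ ∫ x, ‖f x‖ := by
  have h1 : ∫ x, mollify n (fun y => ‖f y‖) x = ∫ x, ‖f x‖ := by
    unfold mollify
    rw [integral_convolution _ (mollifierBump_normed_integrable n) hf.norm,
      (mollifierBump n).integral_normed]
    simp
  rw [← h1]
  refine integral_mono (integrable_mollify n hf).norm (integrable_mollify n hf.norm) fun x => ?_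
  simp only [mollify_apply]
  refine (norm_integral_le_integral_norm _).trans_eq (integral_congr_ae ?_)
  refine Eventually.of_forall fun t => ?_
  simp [norm_smul, abs_of_nonneg ((mollifierBump n).nonneg_normed (x - t))]

theorem ae_tendsto_mollify [CompleteSpace V] {f : Plane → V} (hf : Integrable f) :
    ∀ᵐ x, Tendsto (fun n => mollify n f x) atTop (𝓝 (f x)) := by
  refine ContDiffBump.ae_convolution_tendsto_right_of_locallyIntegrable (K := 2)
    tendsto_mollifierBump_rOut (Eventually.of_forall fun n => ?_) hf.locallyIntegrable
  simp [mollifierBump, div_eq_mul_inv]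

theorem tendsto_integral_norm_mollify_sub [CompleteSpace V] {f : Plane → V}
    (hf : Integrable f) :
    Tendsto (fun n => ∫ x, ‖mollify n f x - f x‖) atTop (𝓝 0) :=
  tendsto_integral_norm_sub_of_tendsto_ae (fun n => integrable_mollify n hf) hf
    (fun n => integral_norm_mollify_le n hf) (ae_tendsto_mollify hf)

/-- Mollification commutes with weak differentiation: at a point whose distance to the complement
of `K` exceeds the mollification scale, the derivative of the mollified function is the mollified
weak derivative. The functions are cut off outside the compact set `K` so that the convolutions
are defined on the whole plane. -/
theorem fderiv_mollify_eq {Ω K : Set Plane} {j : Fin 2} {u g : Plane → V}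
    (hug : HasWeakDeriv Ω j u g) (hK : IsCompact K) (hKΩ : K ⊆ Ω) {n : ℕ} {x : Plane}
    (hx : Metric.closedBall x (mollifierBump n).rOut ⊆ K) :
    fderiv ℝ (mollify n (K.indicator u)) x (EuclideanSpace.single j 1)
      = mollify n (K.indicator g) x := by
  obtain ⟨hu, hg, htest⟩ := hug
  set η : Plane → ℝ := (mollifierBump n).normed volume with hη
  have hηs : ContDiff ℝ ∞ η := (mollifierBump n).contDiff_normed
  have hηc : HasCompactSupport η := (mollifierBump n).hasCompactSupport_normed
  have huK : Integrable (K.indicator u) :=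
    (integrable_indicator_iff hK.measurableSet).2 (hu.integrableOn_compact_subset hKΩ hK)
  set φ : Plane → ℝ := fun t => η (x - t) with hφ
  have hφs : ContDiff ℝ ∞ φ := hηs.comp (contDiff_const.sub contDiff_id)
  have hφsupp : tsupport φ ⊆ Metric.closedBall x (mollifierBump n).rOut := by
    refine closure_minimal ?_ Metric.isClosed_closedBall
    intro t ht
    have : x - t ∈ Function.support η := ht
    rw [hη, (mollifierBump n).support_normed_eq] at this
    rw [Metric.mem_closedBall, dist_comm, dist_eq_norm]
    exact (mem_ball_zero_iff.1 this).le
  have hφc : HasCompactSupport φ :=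
    (isCompact_closedBall _ _).of_isClosed_subset (isClosed_tsupport _) hφsupp
  have hφd : ∀ t, partialDeriv j φ t = - fderiv ℝ η (x - t) (EuclideanSpace.single j 1) := by
    intro t
    have h1 : HasFDerivAt (fun t : Plane => x - t) (-ContinuousLinearMap.id ℝ Plane) t :=
      (hasFDerivAt_id t).const_sub x
    have h2 := ((hηs.differentiable (by simp)) (x - t)).hasFDerivAt.comp t h1
    have h3 : fderiv ℝ φ t = _ := h2.fderiv
    simp [partialDeriv, h3]
  have hcut : ∀ (c : Plane → ℝ) (w : Plane → V), tsupport c ⊆ K →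
      ∫ t in Ω, c t • w t = ∫ t, c t • K.indicator w t := by
    intro c w hc
    rw [← setIntegral_eq_integral_of_forall_compl_eq_zero (s := Ω)
      (f := fun t => c t • K.indicator w t)]
    · refine integral_congr_ae (Eventually.of_forall fun t => ?_)
      by_cases ht : t ∈ K
      · simp [ht]
      · simp [image_eq_zero_of_notMem_tsupport fun h => ht (hc h)]
    · intro t ht
      simp [indicator_of_notMem fun h => ht (hKΩ h)]
  have key := htest φ hφs hφc (hφsupp.trans (hx.trans hKΩ))
  have hpd : tsupport (partialDeriv j φ) ⊆ K :=
    (tsupport_fderiv_apply_subset ℝ (f := φ) (EuclideanSpace.single j 1)).trans (hφsupp.trans hx)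
  rw [hcut _ _ hpd, hcut _ _ (hφsupp.trans hx)] at key
  have hfd := hηc.hasFDerivAt_convolution_left (𝕜 := ℝ) (ContinuousLinearMap.lsmul ℝ ℝ)
    (hηs.of_le (by exact_mod_cast le_top)) huK.locallyIntegrable x
  have hfd' : fderiv ℝ (mollify n (K.indicator u)) x = _ := hfd.fderiv
  rw [hfd', mollify_apply, convolution_eq_swap, ContinuousLinearMap.integral_apply]
  · rw [← neg_inj, ← key, ← integral_neg]
    refine integral_congr_ae (Eventually.of_forall fun t => ?_)
    simp [hφd]
  · have := (hηc.fderiv ℝ).convolutionExists_left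
      (ContinuousLinearMap.precompL Plane (ContinuousLinearMap.lsmul ℝ ℝ (E := V)))
      (hηs.continuous_fderiv (by simp)) huK.locallyIntegrable x
    exact this.integrable_swap

end Mollify

/-! ### Weak derivatives -/

section WeakDeriv

theorem _root_.MeasureTheory.LocallyIntegrableOn.mono_of_isOpen {V W : Type*} [NormedAddCommGroup V]
    [NormedAddCommGroup W] {Ω : Set Plane} (hΩ : IsOpen Ω) {f : Plane → V} {h : Plane → W}
    (hf : LocallyIntegrableOn f Ω) (hm : AEStronglyMeasurable h (volume.restrict Ω))
    (hle : ∀ x, ‖h x‖ ≤ ‖f x‖) : LocallyIntegrableOn h Ω := by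
  rw [locallyIntegrableOn_iff hΩ.isLocallyClosed] at hf ⊢
  intro k hk hkc
  exact (hf k hk hkc).norm.mono' (hm.mono_measure (Measure.restrict_mono hk le_rfl))
    (Eventually.of_forall hle)

variable {V : Type*} [NormedAddCommGroup V] [NormedSpace ℝ V]

theorem HasWeakDeriv.ae_eq [CompleteSpace V] {Ω : Set Plane} (hΩ : IsOpen Ω) {j : Fin 2}
    {u g g' : Plane → V} (hg : HasWeakDeriv Ω j u g) (hg' : HasWeakDeriv Ω j u g') :
    g =ᵐ[volume.restrict Ω] g' := by
  obtain ⟨-, hgi, hg⟩ := hg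
  obtain ⟨-, hgi', hg'⟩ := hg'
  have hloc : ∀ (w : Plane → V), LocallyIntegrableOn w Ω → ∀ φ : Plane → ℝ, ContDiff ℝ ∞ φ →
      HasCompactSupport φ → tsupport φ ⊆ Ω → IntegrableOn (fun x => φ x • w x) Ω := by
    intro w hw φ hφ hφc hφΩ
    have h1 : IntegrableOn (fun x => φ x • w x) (tsupport φ) :=
      (hw.integrableOn_compact_subset hφΩ hφc).continuousOn_smul
        hφ.continuous.continuousOn hφc
    refine (IntegrableOn.integrable_of_forall_notMem_eq_zero h1 fun x hx => ?_).integrableOn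
    simp [image_eq_zero_of_notMem_tsupport hx]
  have h0 := hΩ.ae_eq_zero_of_integral_contDiff_smul_eq_zero (f := fun x => g x - g' x)
    (μ := volume) (hgi.sub hgi') fun φ hφ hφc hφΩ => by
      rw [← setIntegral_eq_integral_of_forall_compl_eq_zero (s := Ω)]
      · simp_rw [smul_sub]
        rw [integral_sub (hloc g hgi φ hφ hφc hφΩ) (hloc g' hgi' φ hφ hφc hφΩ), sub_eq_zero,
          ← neg_inj, ← hg φ hφ hφc hφΩ, ← hg' φ hφ hφc hφΩ]
      · intro x hx
        simp [image_eq_zero_of_notMem_tsupport fun h => hx (hφΩ h)]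
  rw [EventuallyEq, ae_restrict_iff' hΩ.measurableSet]
  filter_upwards [h0] with x hx hxΩ using sub_eq_zero.1 (hx hxΩ)

theorem hasWeakDeriv_weakDeriv {Ω : Set Plane} {j : Fin 2} {u : Plane → V}
    (h : ∃ g, HasWeakDeriv Ω j u g) : HasWeakDeriv Ω j u (weakDeriv Ω j u) := by
  rw [weakDeriv, dif_pos h]
  exact h.choose_spec

theorem HasWeakDeriv.weakDeriv_ae_eq [CompleteSpace V] {Ω : Set Plane} (hΩ : IsOpen Ω)
    {j : Fin 2} {u g : Plane → V} (hg : HasWeakDeriv Ω j u g) :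
    weakDeriv Ω j u =ᵐ[volume.restrict Ω] g :=
  (hasWeakDeriv_weakDeriv ⟨g, hg⟩).ae_eq hΩ hg

theorem HasWeakDeriv.const_smul {Ω : Set Plane} {j : Fin 2} {u g : Plane → V}
    (hg : HasWeakDeriv Ω j u g) (c : ℝ) :
    HasWeakDeriv Ω j (fun x => c • u x) (fun x => c • g x) := by
  obtain ⟨hu, hgi, h⟩ := hg
  refine ⟨hu.smul c, hgi.smul c, fun φ hφ hφc hφΩ => ?_⟩
  simp_rw [smul_comm _ c, integral_smul, h φ hφ hφc hφΩ, smul_neg]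

theorem hasWeakDeriv_const [CompleteSpace V] (Ω : Set Plane) (j : Fin 2) (c : V) :
    HasWeakDeriv Ω j (fun _ => c) (fun _ => 0) := by
  refine ⟨(locallyIntegrable_const c).locallyIntegrableOn _,
    (locallyIntegrable_const 0).locallyIntegrableOn _, fun φ hφ hφc hφΩ => ?_⟩
  rw [setIntegral_eq_integral_of_forall_compl_eq_zero]
  · have hd : Integrable (fun x => fderiv ℝ φ x (EuclideanSpace.single j 1)) :=
      ((hφ.continuous_fderiv (by simp)).clm_apply continuous_const).integrable_of_hasCompactSupport
        (hφc.fderiv_apply ℝ _)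
    have := integral_smul_fderiv_eq_neg_fderiv_smul_of_integrable (μ := (volume : Measure Plane))
      (𝕜 := ℝ) (f := φ) (g := fun _ : Plane => c) (v := EuclideanSpace.single j 1)
      (hd.smul_const c) (by simp)
      ((hφ.continuous.integrable_of_hasCompactSupport hφc).smul_const c)
      (fun x _ => hφ.differentiable (by simp) x) (fun x _ => differentiableAt_const c)
    simpa [partialDeriv] using this.symm
  · intro x hx
    have : x ∉ tsupport (partialDeriv j φ) := fun h => hx (hφΩ
      (tsupport_fderiv_apply_subset ℝ (f := φ) (EuclideanSpace.single j 1) h))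
    simp [image_eq_zero_of_notMem_tsupport this]

end WeakDeriv

section ChainRule

variable {V W : Type*} [NormedAddCommGroup V] [NormedSpace ℝ V]
  [NormedAddCommGroup W] [NormedSpace ℝ W]

theorem norm_le_of_norm_fderiv_le_one {G : V → W} (hG : ContDiff ℝ 1 G) (hG0 : G 0 = 0)
    (hG1 : ∀ z, ‖fderiv ℝ G z‖ ≤ 1) (z w : V) : ‖G z - G w‖ ≤ ‖z - w‖ ∧ ‖G z‖ ≤ ‖z‖ := by
  have hL : LipschitzWith 1 G :=
    lipschitzWith_of_nnnorm_fderiv_le (𝕜 := ℝ) (hG.differentiable (by simp)) fun z => hG1 z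
  constructor
  · simpa using hL.norm_sub_le z w
  · simpa [hG0] using hL.norm_sub_le z 0

/-- The chain rule for a mollified function with compactly supported test function, in the
integrated form that passes to the limit. -/
theorem integral_partialDeriv_smul_comp_mollify {Ω K : Set Plane} {j : Fin 2} {u g : Plane → V}
    (hug : HasWeakDeriv Ω j u g) {G : V → W} (hG : ContDiff ℝ 1 G) (hK : IsCompact K)
    (hKΩ : K ⊆ Ω) {φ : Plane → ℝ} (hφ : ContDiff ℝ ∞ φ) (hφc : HasCompactSupport φ) {n : ℕ}
    (hn : ∀ x ∈ tsupport φ, Metric.closedBall x (mollifierBump n).rOut ⊆ K) :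
    ∫ x, partialDeriv j φ x • G (mollify n (K.indicator u) x)
      = - ∫ x, φ x • fderiv ℝ G (mollify n (K.indicator u) x) (mollify n (K.indicator g) x) := by
  set v : Plane → V := mollify n (K.indicator u) with hv
  have huK : Integrable (K.indicator u) :=
    (integrable_indicator_iff hK.measurableSet).2 (hug.1.integrableOn_compact_subset hKΩ hK)
  have hvs : ContDiff ℝ 1 v := contDiff_mollify n huK.locallyIntegrable
  have hGv : ContDiff ℝ 1 (fun x => G (v x)) := hG.comp hvs
  have hdφ : Continuous (fun x => fderiv ℝ φ x (EuclideanSpace.single j 1)) :=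
    (hφ.continuous_fderiv (by simp)).clm_apply continuous_const
  have hdG : Continuous
      (fun x => fderiv ℝ (fun x => G (v x)) x (EuclideanSpace.single j 1)) :=
    (hGv.continuous_fderiv (by simp)).clm_apply continuous_const
  have ibp := integral_smul_fderiv_eq_neg_fderiv_smul_of_integrable
    (μ := (volume : Measure Plane)) (𝕜 := ℝ) (f := φ) (g := fun x => G (v x))
    (v := EuclideanSpace.single j 1)
    ((hdφ.smul hGv.continuous).integrable_of_hasCompactSupport
      ((hφc.fderiv_apply ℝ _).smul_right))
    ((hφ.continuous.smul hdG).integrable_of_hasCompactSupport hφc.smul_right)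
    ((hφ.continuous.smul hGv.continuous).integrable_of_hasCompactSupport hφc.smul_right)
    (fun x _ => hφ.differentiable (by simp) x) (fun x _ => hGv.differentiable (by simp) x)
  rw [eq_neg_iff_add_eq_zero, add_comm, ← eq_neg_iff_add_eq_zero]
  refine Eq.trans (integral_congr_ae (Eventually.of_forall fun x => ?_)) ibp
  by_cases hx : x ∈ tsupport φ
  · have h1 : HasFDerivAt (fun x => G (v x)) ((fderiv ℝ G (v x)).comp (fderiv ℝ v x)) x :=
      ((hG.differentiable (by simp)) (v x)).hasFDerivAt.comp x
        ((hvs.differentiable (by simp)) x).hasFDerivAt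
    simp only [h1.fderiv, ContinuousLinearMap.comp_apply]
    rw [hv, fderiv_mollify_eq hug hK hKΩ (hn x hx)]
  · simp [image_eq_zero_of_notMem_tsupport hx]

/-- The chain rule for weak derivatives, for a contraction `G` of class `C¹` that fixes `0`. -/
theorem HasWeakDeriv.comp [CompleteSpace V] {Ω : Set Plane} (hΩ : IsOpen Ω) {j : Fin 2}
    {u g : Plane → V}
    (hug : HasWeakDeriv Ω j u g) {G : V → W} (hG : ContDiff ℝ 1 G) (hG0 : G 0 = 0)
    (hG1 : ∀ z, ‖fderiv ℝ G z‖ ≤ 1) :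
    HasWeakDeriv Ω j (fun x => G (u x)) (fun x => fderiv ℝ G (u x) (g x)) := by
  have hum := hug.1.aestronglyMeasurable
  have hgm := hug.2.1.aestronglyMeasurable
  have hDc : Continuous (fun p : V × V => fderiv ℝ G p.1 p.2) :=
    ((hG.continuous_fderiv (by simp)).comp continuous_fst).clm_apply continuous_snd
  have hDle : ∀ z w, ‖fderiv ℝ G z w‖ ≤ ‖w‖ := fun z w => by
    simpa using (fderiv ℝ G z).le_of_opNorm_le (hG1 z) w
  have hGle : ∀ z, ‖G z‖ ≤ ‖z‖ := fun z => (norm_le_of_norm_fderiv_le_one hG hG0 hG1 z z).2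
  refine ⟨hug.1.mono_of_isOpen hΩ (hG.continuous.comp_aestronglyMeasurable hum)
    (fun x => hGle _), hug.2.1.mono_of_isOpen hΩ
    (hDc.comp_aestronglyMeasurable (hum.prodMk hgm)) (fun x => hDle _ _),
    fun φ hφ hφc hφΩ => ?_⟩
  obtain ⟨δ, hδ, hδΩ⟩ := hφc.isCompact.exists_cthickening_subset_open hΩ hφΩ
  set K := Metric.cthickening δ (tsupport φ) with hKdef
  have hK : IsCompact K := hφc.isCompact.cthickening
  have hφK : tsupport φ ⊆ K := Metric.self_subset_cthickening _
  set u' := K.indicator u with hu'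
  set g' := K.indicator g with hg'
  have hu'i : Integrable u' :=
    (integrable_indicator_iff hK.measurableSet).2 (hug.1.integrableOn_compact_subset hδΩ hK)
  have hg'i : Integrable g' :=
    (integrable_indicator_iff hK.measurableSet).2 (hug.2.1.integrableOn_compact_subset hδΩ hK)
  have hdφc : Continuous (partialDeriv j φ) :=
    (hφ.continuous_fderiv (by simp)).clm_apply continuous_const
  have hdφs : tsupport (partialDeriv j φ) ⊆ tsupport φ :=
    tsupport_fderiv_apply_subset ℝ (f := φ) (EuclideanSpace.single j 1)
  obtain ⟨C, hC⟩ := hdφc.bounded_above_of_compact_support (hφc.fderiv_apply ℝ _)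
  obtain ⟨D, hD⟩ := hφ.continuous.bounded_above_of_compact_support hφc
  have hC0 : 0 ≤ C := (norm_nonneg _).trans (hC 0)
  have hD0 : 0 ≤ D := (norm_nonneg _).trans (hD 0)
  have hev : ∀ᶠ n in atTop, ∫ x, partialDeriv j φ x • G (mollify n u' x)
      = - ∫ x, φ x • fderiv ℝ G (mollify n u' x) (mollify n g' x) := by
    filter_upwards [tendsto_mollifierBump_rOut.eventually_lt_const hδ] with n hn
    refine integral_partialDeriv_smul_comp_mollify hug hG hK hδΩ hφ hφc fun x hx => ?_
    exact (Metric.closedBall_subset_closedBall hn.le).trans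
      (Metric.closedBall_subset_cthickening hx δ)
  have hun : ∀ n, Integrable (mollify n u') := fun n => integrable_mollify n hu'i
  have hgn : ∀ n, Integrable (mollify n g') := fun n => integrable_mollify n hg'i
  have hGi : ∀ v : Plane → V, Integrable v →
      Integrable (fun x => partialDeriv j φ x • G (v x)) := fun v hv =>
    Integrable.bdd_smul (hv.mono (hG.continuous.comp_aestronglyMeasurable hv.1)
        (Eventually.of_forall fun x => hGle _)) C hdφc.aestronglyMeasurable
      (Eventually.of_forall hC)
  have hDi : ∀ v w : Plane → V, Integrable v → Integrable w →
      Integrable (fun x => φ x • fderiv ℝ G (v x) (w x)) := fun v w hv hw =>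
    Integrable.bdd_smul (hw.mono (hDc.comp_aestronglyMeasurable (hv.1.prodMk hw.1))
        (Eventually.of_forall fun x => hDle _ _)) D hφ.continuous.aestronglyMeasurable
      (Eventually.of_forall hD)
  have hlim1 : Tendsto (fun n => ∫ x, partialDeriv j φ x • G (mollify n u' x)) atTop
      (𝓝 (∫ x, partialDeriv j φ x • G (u' x))) := by
    rw [tendsto_iff_norm_sub_tendsto_zero]
    have h0 := (tendsto_integral_norm_mollify_sub hu'i).const_mul C
    rw [mul_zero] at h0
    refine squeeze_zero (fun n => norm_nonneg _) (fun n => ?_) h0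
    rw [← integral_sub (hGi _ (hun n)) (hGi _ hu'i), ← integral_const_mul]
    refine norm_integral_le_of_norm_le (((hun n).sub hu'i).norm.const_mul C)
      (Eventually.of_forall fun x => ?_)
    rw [← smul_sub, norm_smul]
    exact mul_le_mul (hC x) (norm_le_of_norm_fderiv_le_one hG hG0 hG1 _ _).1
      (norm_nonneg _) hC0
  -- The gradient converges in `L¹`, and the coefficients `fderiv ℝ G` converge boundedly.
  have hlim2 : Tendsto (fun n => ∫ x, φ x • fderiv ℝ G (mollify n u' x) (mollify n g' x - g' x))
      atTop (𝓝 0) := by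
    rw [tendsto_zero_iff_norm_tendsto_zero]
    have h0 := (tendsto_integral_norm_mollify_sub hg'i).const_mul D
    rw [mul_zero] at h0
    refine squeeze_zero (fun n => norm_nonneg _) (fun n => ?_) h0
    rw [← integral_const_mul]
    refine norm_integral_le_of_norm_le (((hgn n).sub hg'i).norm.const_mul D)
      (Eventually.of_forall fun x => ?_)
    rw [norm_smul]
    exact mul_le_mul (hD x) (hDle _ _) (norm_nonneg _) hD0
  have hlim3 : Tendsto (fun n => ∫ x, φ x • fderiv ℝ G (mollify n u' x) (g' x)) atTop
      (𝓝 (∫ x, φ x • fderiv ℝ G (u' x) (g' x))) := by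
    refine tendsto_integral_of_dominated_convergence (fun x => D * ‖g' x‖)
      (fun n => (hDi _ _ (hun n) hg'i).1) (hg'i.norm.const_mul D)
      (fun n => Eventually.of_forall fun x => ?_) ?_
    · rw [norm_smul]
      exact mul_le_mul (hD x) (hDle _ _) (norm_nonneg _) hD0
    · filter_upwards [ae_tendsto_mollify hu'i] with x hx
      have : Continuous fun z => fderiv ℝ G z (g' x) :=
        (hG.continuous_fderiv (by simp)).clm_apply continuous_const
      exact ((this.tendsto (u' x)).comp hx).const_smul (φ x)
  have hlim4 : Tendsto (fun n => - ∫ x, φ x • fderiv ℝ G (mollify n u' x) (mollify n g' x)) atTop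
      (𝓝 (- ∫ x, φ x • fderiv ℝ G (u' x) (g' x))) := by
    have := (hlim2.add hlim3).neg
    rw [zero_add] at this
    refine this.congr fun n => ?_
    rw [← integral_add (hDi _ (fun x => mollify n g' x - g' x) (hun n) ((hgn n).sub hg'i))
      (hDi _ _ (hun n) hg'i)]
    simp_rw [← smul_add, ← map_add, sub_add_cancel]
  have heq := tendsto_nhds_unique_of_eventuallyEq hlim1 hlim4 hev
  have hres : ∀ (c : Plane → ℝ) (w w' : Plane → W), tsupport c ⊆ tsupport φ →
      (∀ x ∈ K, w x = w' x) → ∫ x in Ω, c x • w x = ∫ x, c x • w' x := by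
    intro c w w' hc hw
    rw [setIntegral_eq_integral_of_forall_compl_eq_zero]
    · refine integral_congr_ae (Eventually.of_forall fun x => ?_)
      by_cases hx : x ∈ K
      · simp [hw x hx]
      · simp [image_eq_zero_of_notMem_tsupport fun h => hx (hφK (hc h))]
    · intro x hx
      simp [image_eq_zero_of_notMem_tsupport fun h => hx (hφΩ (hc h))]
  rw [hres _ _ (fun x => G (u' x)) hdφs fun x hx => by simp [hu', hx],
    hres _ _ (fun x => fderiv ℝ G (u' x) (g' x)) subset_rfl fun x hx => by simp [hu', hg', hx]]
  exact heq

end ChainRule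

/-! ### A smooth truncation that commutes with phase rotations -/

/-- The map `z ↦ z / (1 + ε |z|²)`, a bounded smooth contraction of `ℂ` for `ε > 0`. -/
noncomputable def softTruncation (ε : ℝ) (z : ℂ) : ℂ := (1 + ε * ‖z‖ ^ 2)⁻¹ • z

theorem contDiff_softTruncation {ε : ℝ} (hε : 0 ≤ ε) : ContDiff ℝ 1 (softTruncation ε) := by
  have h : ContDiff ℝ 1 fun z : ℂ => 1 + ε * ‖z‖ ^ 2 :=
    contDiff_const.add (contDiff_const.mul (contDiff_norm_sq ℝ))
  exact (h.inv fun z => by positivity).smul contDiff_id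

theorem softTruncation_zero (ε : ℝ) : softTruncation ε 0 = 0 := by simp [softTruncation]

theorem fderiv_softTruncation {ε : ℝ} (hε : 0 ≤ ε) (z w : ℂ) :
    fderiv ℝ (softTruncation ε) z w = (1 + ε * ‖z‖ ^ 2)⁻¹ • w
      - (((1 + ε * ‖z‖ ^ 2) ^ 2)⁻¹ * (2 * ε * inner ℝ z w)) • z := by
  have hne : (1 + ε * ‖z‖ ^ 2) ≠ 0 := by positivity
  have h1 : HasFDerivAt (fun z : ℂ => 1 + ε * ‖z‖ ^ 2) (ε • (2 • innerSL ℝ z)) z :=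
    ((hasStrictFDerivAt_norm_sq z).hasFDerivAt.const_mul ε).const_add 1
  have h2 := ((hasDerivAt_inv hne).comp_hasFDerivAt z h1).smul (hasFDerivAt_id (𝕜 := ℝ) z)
  have h3 : fderiv ℝ (softTruncation ε) z = _ := h2.fderiv
  rw [h3]
  simp
  ring

theorem norm_fderiv_softTruncation_le {ε : ℝ} (hε : 0 ≤ ε) (z : ℂ) :
    ‖fderiv ℝ (softTruncation ε) z‖ ≤ 1 := by
  refine ContinuousLinearMap.opNorm_le_bound _ zero_le_one fun w => ?_
  rw [fderiv_softTruncation hε, one_mul]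
  refine le_of_sq_le_sq ?_ (norm_nonneg _)
  set r := (1 + ε * ‖z‖ ^ 2)⁻¹ with hr
  set p : ℝ := inner ℝ z w with hp
  have hr0 : 0 ≤ r := by positivity
  have hr1 : r ≤ 1 := inv_le_one_of_one_le₀ (by nlinarith [sq_nonneg ‖z‖])
  have hrs : r * (ε * ‖z‖ ^ 2) = 1 - r := by
    rw [hr]
    field_simp
    ring
  rw [norm_sub_sq_real, inner_smul_left, inner_smul_right, real_inner_comm, ← hp, norm_smul,
    norm_smul, mul_pow, mul_pow]
  have key : r ^ 2 * ‖w‖ ^ 2 - 4 * ε * p ^ 2 * r ^ 4 ≤ ‖w‖ ^ 2 := by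
    have : r ^ 2 * ‖w‖ ^ 2 ≤ 1 * ‖w‖ ^ 2 := by
      gcongr
      exact pow_le_one₀ hr0 hr1
    have : 0 ≤ 4 * ε * p ^ 2 * r ^ 4 := by positivity
    linarith
  refine le_trans (le_of_eq ?_) key
  have e1 : ((1 + ε * ‖z‖ ^ 2) ^ 2)⁻¹ = r ^ 2 := by rw [hr, inv_pow]
  simp only [Real.norm_eq_abs, sq_abs, e1, RCLike.conj_to_real]
  linear_combination (4 * ε * p ^ 2 * r ^ 3) * hrs

/-- The derivative of the truncation along the orbits of the phase rotation. -/
theorem fderiv_softTruncation_rotation {ε : ℝ} (hε : 0 ≤ ε) (c : ℝ) (z : ℂ) :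
    fderiv ℝ (softTruncation ε) z (Complex.I * c * z) = Complex.I * c * softTruncation ε z := by
  have h0 : (inner ℝ z (Complex.I * c * z) : ℝ) = 0 := by
    simp [Complex.inner]
    ring
  rw [fderiv_softTruncation hε, h0, softTruncation]
  simp
  ring

theorem norm_softTruncation_le {ε : ℝ} (hε : 0 ≤ ε) (z : ℂ) : ‖softTruncation ε z‖ ≤ ‖z‖ :=
  (norm_le_of_norm_fderiv_le_one (contDiff_softTruncation hε) (softTruncation_zero ε)
    (norm_fderiv_softTruncation_le hε) z z).2

theorem norm_softTruncation_le_const {ε : ℝ} (hε : 0 < ε) (z : ℂ) :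
    ‖softTruncation ε z‖ ≤ 1 + ε⁻¹ := by
  rw [softTruncation, norm_smul, norm_inv, Real.norm_of_nonneg (by positivity), ← div_eq_inv_mul,
    div_le_iff₀ (by positivity)]
  have : (1 + ε⁻¹) * (1 + ε * ‖z‖ ^ 2) = 1 + ‖z‖ ^ 2 + ε⁻¹ + ε * ‖z‖ ^ 2 := by
    field_simp
    ring
  rw [this]
  have h1 : 0 ≤ ε⁻¹ := by positivity
  have h2 : 0 ≤ ε * ‖z‖ ^ 2 := by positivity
  nlinarith [sq_nonneg (‖z‖ - 1 / 2)]

theorem tendsto_softTruncation (z : ℂ) :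
    Tendsto (fun n : ℕ => softTruncation (1 / ((n : ℝ) + 1)) z) atTop (𝓝 z) := by
  have h1 : Tendsto (fun n : ℕ => 1 + 1 / ((n : ℝ) + 1) * ‖z‖ ^ 2) atTop (𝓝 1) := by
    simpa using ((tendsto_one_div_add_atTop_nhds_zero_nat (𝕜 := ℝ)).mul_const (‖z‖ ^ 2)).const_add 1
  simpa [softTruncation] using (h1.inv₀ one_ne_zero).smul_const z

/-! ### Truncation in the magnetic form domain -/

section Magnetic

variable {Ω : Set Plane} {b : ℝ} {E : Plane → Plane} {u : Plane → ℂ}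

theorem memLp_two_mul_of_bounded {e : Plane → ℝ} (he : MemLp e 2 (volume.restrict Ω))
    {ψ : Plane → ℂ} (hψ : AEStronglyMeasurable ψ (volume.restrict Ω)) {M : ℝ}
    (hM : ∀ x, ‖ψ x‖ ≤ M) (b : ℝ) :
    MemLp (fun x => Complex.I * (b : ℂ) * (e x : ℂ) * ψ x) 2 (volume.restrict Ω) := by
  have hec : AEStronglyMeasurable (fun x => (e x : ℂ)) (volume.restrict Ω) :=
    Complex.continuous_ofReal.comp_aestronglyMeasurable he.1
  refine he.of_le_mul (c := |b| * M) ((hec.const_mul _).mul hψ) (Eventually.of_forall fun x => ?_)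
  simp only [norm_mul, Complex.norm_I, one_mul, Complex.norm_real, Real.norm_eq_abs]
  calc |b| * |e x| * ‖ψ x‖ ≤ |b| * |e x| * M := by gcongr; exact hM x
    _ = |b| * M * |e x| := by ring

/-- Truncation does not increase the length of the magnetic gradient, because the truncation is a
contraction that commutes with phase rotations. -/
theorem norm_magDeriv_softTruncation_le (hΩ : IsOpen Ω) {ε : ℝ} (hε : 0 ≤ ε) {j : Fin 2}
    (hu : ∃ g, HasWeakDeriv Ω j u g) :
    ∀ᵐ x ∂volume.restrict Ω,
      ‖magDeriv Ω b E j (fun y => softTruncation ε (u y)) x‖ ≤ ‖magDeriv Ω b E j u x‖ := by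
  have h := ((hasWeakDeriv_weakDeriv hu).comp hΩ (contDiff_softTruncation hε)
    (softTruncation_zero ε) (norm_fderiv_softTruncation_le hε)).weakDeriv_ae_eq hΩ
  filter_upwards [h] with x hx
  have heq : magDeriv Ω b E j (fun y => softTruncation ε (u y)) x
      = fderiv ℝ (softTruncation ε) (u x) (magDeriv Ω b E j u x) := by
    have h2 := fderiv_softTruncation_rotation hε (b * E x j) (u x)
    push_cast at h2
    rw [magDeriv, magDeriv, hx, map_sub, mul_assoc Complex.I, h2]
  rw [heq]
  simpa using (fderiv ℝ (softTruncation ε) (u x)).le_of_opNorm_le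
    (norm_fderiv_softTruncation_le hε (u x)) (magDeriv Ω b E j u x)

/-- Truncated elements of the form domain belong to `H¹`, since the potential is in `L²`. -/
theorem memH1_softTruncation (hΩ : IsOpen Ω)
    (hE : ∀ j, MemLp (fun x => E x j) 2 (volume.restrict Ω))
    (hu : MemFormDomain Ω b E u) {ε : ℝ} (hε : 0 < ε) :
    MemH1 Ω (fun x => softTruncation ε (u x)) := by
  have hm : AEStronglyMeasurable (fun x => softTruncation ε (u x)) (volume.restrict Ω) :=
    (contDiff_softTruncation hε.le).continuous.comp_aestronglyMeasurable hu.1.1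
  refine ⟨hu.1.of_le hm (Eventually.of_forall fun x => norm_softTruncation_le hε.le _),
    fun j => ?_⟩
  have hw := (hasWeakDeriv_weakDeriv (hu.2 j).1).comp hΩ (contDiff_softTruncation hε.le)
    (softTruncation_zero ε) (norm_fderiv_softTruncation_le hε.le)
  have hw' := hasWeakDeriv_weakDeriv ⟨_, hw⟩
  refine ⟨_, ?_, hw'⟩
  have hsplit : weakDeriv Ω j (fun x => softTruncation ε (u x))
      = magDeriv Ω b E j (fun x => softTruncation ε (u x))
        + fun x => Complex.I * (b : ℂ) * (E x j : ℂ) * softTruncation ε (u x) := by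
    ext x
    simp [magDeriv]
  have hpot := memLp_two_mul_of_bounded (hE j) hm
    (fun x => norm_softTruncation_le_const hε (u x)) b
  have hmag : MemLp (magDeriv Ω b E j (fun x => softTruncation ε (u x))) 2
      (volume.restrict Ω) := by
    refine (hu.2 j).2.of_le (hw'.2.1.aestronglyMeasurable.sub hpot.1)
      (norm_magDeriv_softTruncation_le hΩ hε.le (hu.2 j).1)
  rw [hsplit]
  exact hmag.add hpot

theorem integrable_norm_sq_of_memLp {f : Plane → ℂ} (hf : MemLp f 2 (volume.restrict Ω)) :
    Integrable (fun x => ‖f x‖ ^ 2) (volume.restrict Ω) :=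
  hf.integrable_norm_pow (by norm_num)

/-- If the magnetic Rayleigh quotient of some element of the form domain is below `m`, then so is
that of some bounded function in `H¹`. -/
theorem exists_bounded_magForm_lt (hΩ : IsOpen Ω)
    (hE : ∀ j, MemLp (fun x => E x j) 2 (volume.restrict Ω)) (hu : MemFormDomain Ω b E u) {m : ℝ}
    (hlt : magForm Ω b E u < m * ∫ x in Ω, ‖u x‖ ^ 2) :
    ∃ ψ : Plane → ℂ, MemH1 Ω ψ ∧ MemFormDomain Ω b E ψ ∧ (∃ M, ∀ x, ‖ψ x‖ ≤ M) ∧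
      magForm Ω b E ψ < m * ∫ x in Ω, ‖ψ x‖ ^ 2 := by
  have hlim : Tendsto (fun n : ℕ => m * ∫ x in Ω, ‖softTruncation (1 / ((n : ℝ) + 1)) (u x)‖ ^ 2)
      atTop (𝓝 (m * ∫ x in Ω, ‖u x‖ ^ 2)) := by
    refine (tendsto_integral_of_dominated_convergence (fun x => ‖u x‖ ^ 2) (fun n => ?_)
      (integrable_norm_sq_of_memLp hu.1) (fun n => ?_) ?_).const_mul m
    · exact (((contDiff_softTruncation (by positivity)).continuous.comp_aestronglyMeasurable
        hu.1.1).norm).pow 2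
    · refine Eventually.of_forall fun x => ?_
      rw [Real.norm_of_nonneg (by positivity)]
      gcongr
      exact norm_softTruncation_le (by positivity) _
    · exact Eventually.of_forall fun x => ((tendsto_softTruncation (u x)).norm).pow 2
  obtain ⟨n, hn⟩ := (hlim.eventually_const_lt hlt).exists
  have hε : 0 < 1 / ((n : ℝ) + 1) := by positivity
  have hH1 := memH1_softTruncation hΩ hE hu hε
  have hle := fun j => norm_magDeriv_softTruncation_le (b := b) (E := E) hΩ hε.le (hu.2 j).1
  have hdom : MemFormDomain Ω b E (fun x => softTruncation (1 / ((n : ℝ) + 1)) (u x)) := by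
    refine ⟨hH1.1, fun j => ⟨(hH1.2 j).imp fun g hg => hg.2, ?_⟩⟩
    have hw := hasWeakDeriv_weakDeriv ((hH1.2 j).imp fun g hg => hg.2)
    refine (hu.2 j).2.of_le (hw.2.1.aestronglyMeasurable.sub (memLp_two_mul_of_bounded (hE j)
      hH1.1.1 (fun x => norm_softTruncation_le_const hε (u x)) b).1) (hle j)
  refine ⟨_, hH1, hdom, ⟨_, fun x => norm_softTruncation_le_const hε (u x)⟩,
    lt_of_le_of_lt ?_ hn⟩
  refine integral_mono_ae (integrable_finsetSum _ fun j _ => integrable_norm_sq_of_memLp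
    (hdom.2 j).2) (integrable_finsetSum _ fun j _ => integrable_norm_sq_of_memLp (hu.2 j).2) ?_
  filter_upwards [hle 0, hle 1] with x h0 h1
  simp only [Fin.sum_univ_two]
  gcongr

theorem magDeriv_const_smul_ae_eq (hΩ : IsOpen Ω) {j : Fin 2} (hu : ∃ g, HasWeakDeriv Ω j u g)
    (t : ℝ) : ∀ᵐ x ∂volume.restrict Ω,
      magDeriv Ω b E j (fun y => t • u y) x = t • magDeriv Ω b E j u x := by
  filter_upwards [((hasWeakDeriv_weakDeriv hu).const_smul t).weakDeriv_ae_eq hΩ] with x hx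
  rw [magDeriv, hx, magDeriv]
  simp only [Complex.real_smul]
  ring

end Magnetic

/-! ### Comparison of the nonlinear and the linear problem -/

section Comparison

variable {Ω : Set Plane} {B : Plane → ℝ} {F : Plane → Plane} {κ H : ℝ}

theorem IsPotentialOf.integral_weakCurl_sub_eq_zero (hF : IsPotentialOf Ω B F) :
    ∫ x in Ω, |weakCurl Ω F x - B x| ^ 2 = 0 := by
  refine integral_eq_zero_of_ae ?_
  filter_upwards [hF.2] with x hx
  simp [hx]

/-- The Ginzburg–Landau energy along the ray `t ↦ (t ψ, F)`. -/
theorem glEnergy_smul (hΩ : IsOpen Ω) (hF : IsPotentialOf Ω B F) {ψ : Plane → ℂ}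
    (hψ : MemFormDomain Ω (κ * H) F ψ) {M : ℝ} (hM : ∀ x, ‖ψ x‖ ≤ M) (t : ℝ) :
    glEnergy Ω B κ H (fun x => t • ψ x) F
      = t ^ 2 * (magForm Ω (κ * H) F ψ - κ ^ 2 * ∫ x in Ω, ‖ψ x‖ ^ 2)
        + t ^ 4 * (κ ^ 2 / 2 * ∫ x in Ω, ‖ψ x‖ ^ 4) := by
  have hi2 := integrable_norm_sq_of_memLp hψ.1
  have him : Integrable (fun x => ∑ j, ‖magDeriv Ω (κ * H) F j ψ x‖ ^ 2) (volume.restrict Ω) :=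
    integrable_finsetSum _ fun j _ => integrable_norm_sq_of_memLp (hψ.2 j).2
  have hi4 : Integrable (fun x => ‖ψ x‖ ^ 4) (volume.restrict Ω) := by
    refine (hi2.const_mul (M ^ 2)).mono' (hψ.1.1.norm.pow 4) (Eventually.of_forall fun x => ?_)
    rw [Real.norm_of_nonneg (by positivity)]
    calc ‖ψ x‖ ^ 4 = ‖ψ x‖ ^ 2 * ‖ψ x‖ ^ 2 := by ring
      _ ≤ M ^ 2 * ‖ψ x‖ ^ 2 := by gcongr; exact hM x
  rw [glEnergy, hF.integral_weakCurl_sub_eq_zero, mul_zero, add_zero, magForm,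
    ← integral_const_mul, ← integral_sub him (hi2.const_mul _), ← integral_const_mul,
    ← integral_const_mul, ← integral_const_mul,
    ← integral_add (f := fun x => t ^ 2 * ((∑ j, ‖magDeriv Ω (κ * H) F j ψ x‖ ^ 2)
      - κ ^ 2 * ‖ψ x‖ ^ 2)) ((him.sub (hi2.const_mul _)).const_mul _)
      ((hi4.const_mul _).const_mul _)]
  refine integral_congr_ae ?_
  filter_upwards [magDeriv_const_smul_ae_eq (b := κ * H) (E := F) hΩ (hψ.2 0).1 t,
    magDeriv_const_smul_ae_eq (b := κ * H) (E := F) hΩ (hψ.2 1).1 t] with x h0 h1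
  have ht : |t| ^ 4 = t ^ 4 := by rw [show 4 = 2 * 2 from rfl, pow_mul, pow_mul, sq_abs]
  simp only [Fin.sum_univ_two, h0, h1, norm_smul, Real.norm_eq_abs, mul_pow, sq_abs, ht]
  ring

/-- The Rayleigh quotients defining the ground-state energy exist: constants are admissible. -/
theorem exists_memFormDomain_ne_zero (hΩ : IsOpen Ω) (hΩb : Bornology.IsBounded Ω)
    (hΩn : Ω.Nonempty) (hE : ∀ j, MemLp (fun x => F x j) 2 (volume.restrict Ω)) (b : ℝ) :
    ∃ u, MemFormDomain Ω b F u ∧ ¬ u =ᵐ[volume.restrict Ω] 0 := by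
  have : IsFiniteMeasure (volume.restrict Ω) := ⟨by simpa using hΩb.measure_lt_top⟩
  have hw := fun j => hasWeakDeriv_const Ω j (1 : ℂ)
  refine ⟨fun _ => 1, ⟨memLp_const 1, fun j => ⟨⟨_, hw j⟩, ?_⟩⟩, fun h => ?_⟩
  · have hpot := (memLp_two_mul_of_bounded (hE j) (ψ := fun _ => 1)
      aestronglyMeasurable_const (M := 1) (by simp) b).neg
    refine hpot.ae_eq ?_
    filter_upwards [(hw j).weakDeriv_ae_eq hΩ] with x hx
    simp [magDeriv, hx]
  · have h0 : ∀ᵐ _ ∂volume.restrict Ω, False := by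
      filter_upwards [h] with x hx using one_ne_zero hx
    rw [eventually_false_iff_eq_bot, ae_eq_bot, Measure.restrict_eq_zero] at h0
    exact (hΩ.measure_pos volume hΩn).ne' h0

/-- If the normal state is a minimizer, then the linear operator has ground-state energy at
least `κ²`. -/
theorem IsGLMinimizer.sq_le_groundEnergy (hΩ : IsOpen Ω) (hΩb : Bornology.IsBounded Ω)
    (hΩn : Ω.Nonempty) (hF : IsPotentialOf Ω B F) (hmin : IsGLMinimizer Ω B κ H 0 F) :
    κ ^ 2 ≤ groundEnergy Ω F (κ * H) := by
  have hE : ∀ j, MemLp (fun x => F x j) 2 (volume.restrict Ω) := fun j => (hF.1.memH1 j).1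
  by_contra! hlt
  obtain ⟨u₀, hu₀, hu₀n⟩ := exists_memFormDomain_ne_zero hΩ hΩb hΩn hE (κ * H)
  rw [groundEnergy] at hlt
  obtain ⟨_, ⟨u, hu, hun, rfl⟩, hlt⟩ :=
    exists_lt_of_csInf_lt (by exact ⟨_, u₀, hu₀, hu₀n, rfl⟩) hlt
  have hpos : 0 < ∫ x in Ω, ‖u x‖ ^ 2 := by
    refine lt_of_le_of_ne (integral_nonneg fun x => by positivity) fun h => hun ?_
    have := (integral_eq_zero_iff_of_nonneg (fun x => by positivity)
      (integrable_norm_sq_of_memLp hu.1)).1 h.symm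
    filter_upwards [this] with x hx
    simpa using hx
  rw [div_lt_iff₀ hpos] at hlt
  obtain ⟨ψ, hψ, hψd, ⟨M, hM⟩, hψlt⟩ := exists_bounded_magForm_lt hΩ hE hu hlt
  set p := κ ^ 2 * (∫ x in Ω, ‖ψ x‖ ^ 2) - magForm Ω (κ * H) F ψ with hp
  set q := κ ^ 2 / 2 * ∫ x in Ω, ‖ψ x‖ ^ 4 with hq
  have hp0 : 0 < p := sub_pos.2 hψlt
  have hq0 : 0 ≤ q := mul_nonneg (by positivity) (integral_nonneg fun x => by positivity)
  -- With `t² = p / (q + 1)` the quartic term does not outweigh the negative quadratic term.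
  set t := √(p / (q + 1)) with ht
  have ht2 : t ^ 2 = p / (q + 1) := Real.sq_sqrt (by positivity)
  have hH1 : MemH1 Ω (fun x => t • ψ x) :=
    ⟨hψ.1.const_smul t, fun j => (hψ.2 j).elim fun g hg =>
      ⟨fun x => t • g x, hg.1.const_smul t, hg.2.const_smul t⟩⟩
  have hzero : glEnergy Ω B κ H 0 F = 0 := by
    have := glEnergy_smul (κ := κ) (H := H) hΩ hF hψd hM 0
    simpa [← Pi.zero_def] using this
  have hle := hmin.2.2 _ F hH1 hF.1
  rw [hzero, glEnergy_smul hΩ hF hψd hM t, ← hq] at hle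
  have hq1 : t ^ 2 * (q + 1) = p := by rw [ht2]; field_simp
  have ht0 : 0 < t ^ 2 := by rw [ht2]; positivity
  have : t ^ 2 * (magForm Ω (κ * H) F ψ - κ ^ 2 * ∫ x in Ω, ‖ψ x‖ ^ 2) + t ^ 4 * q
      = - (t ^ 2 * t ^ 2) := by
    have : magForm Ω (κ * H) F ψ - κ ^ 2 * ∫ x in Ω, ‖ψ x‖ ^ 2 = -p := by rw [hp]; ring
    rw [this, ← hq1]
    ring
  nlinarith [mul_pos ht0 ht0]

end Comparison

end GinzburgLandau

theorem theorem7p1 (Ω Ω₁ Ω₂ : Set GinzburgLandau.Plane) (a : ℝ)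
    (hΩ : GinzburgLandau.StepSample Ω Ω₁ Ω₂ a)
    (F : GinzburgLandau.Plane → GinzburgLandau.Plane)
    (hF : GinzburgLandau.IsPotentialOf Ω (GinzburgLandau.stepField Ω₁ Ω₂ a) F)
    (κ : ℝ) (hκ : 0 < κ) :
    GinzburgLandau.upperLocalField Ω F κ ≤
        GinzburgLandau.upperGlobalField Ω (GinzburgLandau.stepField Ω₁ Ω₂ a) F κ ∧
      GinzburgLandau.lowerLocalField Ω F κ ≤
        GinzburgLandau.lowerGlobalField Ω (GinzburgLandau.stepField Ω₁ Ω₂ a) F κ := by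
  have hne : Ω.Nonempty := by
    have := hΩ.simplyConnected
    exact nonempty_coe_sort.1 inferInstance
  have key : ∀ H, GinzburgLandau.NormalIsOnlyMinimizer Ω (GinzburgLandau.stepField Ω₁ Ω₂ a) F κ H →
      κ ^ 2 ≤ GinzburgLandau.groundEnergy Ω F (κ * H) := fun H hH =>
    hH.1.sq_le_groundEnergy hΩ.isOpen hΩ.bounded hne hF
  exact ⟨sInf_le_sInf (image_mono fun H hH => ⟨hH.1, fun H' hH' => key H' (hH.2 H' hH')⟩),
    sInf_le_sInf (image_mono fun H hH => ⟨hH.1, key H hH.2⟩)⟩
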